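/- A linear map $\Phi : M_m(\mathbb{C}) \to M_n(\mathbb{C})$ is called positive if it sends positive semidefinite matrices to positive semidefinite matrices. A matrix $W \in M_m(\mathbb{C}) \otimes M_n(\mathbb{C})$ is called block-positive if $W = (\mathrm{id}_m \otimes \Phi)(X)$ for some positive semidefinite $X \in M_m(\mathbb{C}) \otimes M_m(\mathbb{C})$ and some positive linear map $\Phi : M_m(\mathbb{C}) \to M_n(\mathbb{C})$; equivalently, if $(\langle a| \otimes \langle b|)\, W\, (|a\rangle \otimes |b\rangle) \geq 0$ for all $|a\rangle \in \mathbb{C}^m$ and $|b\rangle \in \mathbb{C}^n$. Theorem. Let $\mu_1, \mu_2, \mu_3, \mu_4 \in \mathbb{R}$, and let $\mu_1^\downarrow \geq \mu_2^\downarrow \geq \mu_3^\downarrow \geq \mu_4^\downarrow$ be the same numbers sorted in non-increasing order. There exists a block-positive matrix in $M_2(\mathbb{C}) \otimes M_2(\mathbb{C})$ with eigenvalues $\mu_1, \mu_2, \mu_3, \mu_4$ (counted with multiplicity) if and only if the following three inequalities hold: (a) $\mu_3^\downarrow \geq 0$, (b) $\mu_4^\downarrow \geq -\mu_2^\downarrow$,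 and (c) $\mu_4^\downarrow \geq -\sqrt{\mu_1^\downarrow \mu_3^\downarrow}$. -/

import Mathlib

open scoped ComplexOrder Kronecker

/-- A linear map between complex matrix algebras is positive if it sends positive semidefinite
matrices to positive semidefinite matrices. -/
def IsPositiveMap {m n : ℕ}
    (Φ : Matrix (Fin m) (Fin m) ℂ →ₗ[ℂ] Matrix (Fin n) (Fin n) ℂ) : Prop :=
  ∀ X : Matrix (Fin m) (Fin m) ℂ, X.PosSemidef → (Φ X).PosSemidef

/-- The map `id ⊗ Φ`: it applies `Φ` to each block of a block matrix. The tensor product of two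
matrix algebras is the algebra of matrices indexed by pairs (via the Kronecker product). -/
def idTensor (k : ℕ) {m n : ℕ}
    (Φ : Matrix (Fin m) (Fin m) ℂ →ₗ[ℂ] Matrix (Fin n) (Fin n) ℂ)
    (X : Matrix (Fin k × Fin m) (Fin k × Fin m) ℂ) :
    Matrix (Fin k × Fin n) (Fin k × Fin n) ℂ :=
  Matrix.of fun r s => Φ (Matrix.of fun p q => X (r.1, p) (s.1, q)) r.2 s.2

/-- A matrix `W` in `M_m(ℂ) ⊗ M_n(ℂ)` is block-positive if `W = (id_m ⊗ Φ)(X)` for some positive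
semidefinite `X` in `M_m(ℂ) ⊗ M_m(ℂ)` and some positive linear map `Φ : M_m(ℂ) → M_n(ℂ)`. -/
def IsBlockPositive {m n : ℕ} (W : Matrix (Fin m × Fin n) (Fin m × Fin n) ℂ) : Prop :=
  ∃ (Φ : Matrix (Fin m) (Fin m) ℂ →ₗ[ℂ] Matrix (Fin n) (Fin n) ℂ)
    (X : Matrix (Fin m × Fin m) (Fin m × Fin m) ℂ),
    IsPositiveMap Φ ∧ X.PosSemidef ∧ W = idTensor m Φ X

/-- `W` has eigenvalues `μ 0, …, μ (N - 1)`, counted with multiplicity and in any order. -/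
def HasEigenvalueList {ι : Type} [Fintype ι] [DecidableEq ι] {N : ℕ}
    (W : Matrix ι ι ℂ) (μ : Fin N → ℝ) : Prop :=
  W.charpoly.roots = Finset.univ.val.map fun i => (μ i : ℂ)

/-- The entries of `μ` sorted in non-increasing order. -/
noncomputable def sortedDesc {N : ℕ} (μ : Fin N → ℝ) : Fin N → ℝ :=
  fun i => μ (Tuple.sort μ i.rev)

theorem sortedDesc_antitone {N : ℕ} (μ : Fin N → ℝ) : Antitone (sortedDesc μ) :=
  fun _ _ h => Tuple.monotone_sort μ (Fin.rev_le_rev.mpr h)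

theorem idTensor_kronecker (k : ℕ) {m n : ℕ}
    (Φ : Matrix (Fin m) (Fin m) ℂ →ₗ[ℂ] Matrix (Fin n) (Fin n) ℂ)
    (A : Matrix (Fin k) (Fin k) ℂ) (B : Matrix (Fin m) (Fin m) ℂ) :
    idTensor k Φ (A ⊗ₖ B) = A ⊗ₖ Φ B := by
  ext ⟨i, p⟩ ⟨j, q⟩
  have h : (Matrix.of fun p q => (A ⊗ₖ B) (i, p) (j, q)) = A i j • B := by
    ext
    simp [Matrix.kroneckerMap_apply]
  change Φ (Matrix.of fun p q => (A ⊗ₖ B) (i, p) (j, q)) p q = A i j * Φ B p q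
  rw [h, map_smul, Matrix.smul_apply, smul_eq_mul]

/-- Block-positivity in terms of product vectors:
`(⟨a| ⊗ ⟨b|) W (|a⟩ ⊗ |b⟩) ≥ 0` for all `a` and `b`. -/
theorem isBlockPositive_iff {m n : ℕ} (W : Matrix (Fin m × Fin n) (Fin m × Fin n) ℂ) :
    IsBlockPositive W ↔ ∀ (a : Fin m → ℂ) (b : Fin n → ℂ),
      0 ≤ star (fun r : Fin m × Fin n => a r.1 * b r.2) ⬝ᵥ
        W.mulVec (fun r : Fin m × Fin n => a r.1 * b r.2) := by
  constructor
  · rintro ⟨Φ, X, hΦ, hX, rfl⟩ a b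
    let V : Matrix (Fin m × Fin m) (Fin m) ℂ := Matrix.of fun r q => if r.2 = q then a r.1 else 0
    have h := (hΦ _ (hX.conjTranspose_mul_mul_same V)).dotProduct_mulVec_nonneg b
    have e : V.conjTranspose * X * V = ∑ i, ∑ j, (star (a i) * a j) •
        (Matrix.of fun p q => X (i, p) (j, q) : Matrix (Fin m) (Fin m) ℂ) := by
      ext p q
      simp only [V, Matrix.mul_apply, Matrix.conjTranspose_apply, Matrix.of_apply,
        Fintype.sum_prod_type, Matrix.sum_apply, Matrix.smul_apply, smul_eq_mul, apply_ite star,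
        star_zero, ite_mul, mul_ite, zero_mul, mul_zero, Finset.sum_ite_eq', Finset.mem_univ,
        if_true, Finset.sum_mul]
      rw [Finset.sum_comm]
      refine Finset.sum_congr rfl fun i _ => Finset.sum_congr rfl fun j _ => by ring
    rw [e] at h
    convert h using 1
    simp only [map_sum, map_smul, dotProduct, Matrix.mulVec, idTensor, Matrix.of_apply,
      Matrix.sum_apply, Matrix.smul_apply, smul_eq_mul, Fintype.sum_prod_type, Pi.star_apply,
      star_mul', Finset.mul_sum, Finset.sum_mul]
    rw [Finset.sum_comm]
    refine Finset.sum_congr rfl fun p _ => ?_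
    conv_rhs => rw [Finset.sum_comm]
    refine Finset.sum_congr rfl fun i _ => ?_
    conv_rhs => rw [Finset.sum_comm]
    refine Finset.sum_congr rfl fun j _ => Finset.sum_congr rfl fun q _ => ?_
    ring
  · intro h
    let Φ : Matrix (Fin m) (Fin m) ℂ →ₗ[ℂ] Matrix (Fin n) (Fin n) ℂ :=
      { toFun := fun A => Matrix.of fun p q => ∑ i, ∑ j, A i j * W (i, p) (j, q)
        map_add' := fun A B => by
          ext p q
          simp [add_mul, Finset.sum_add_distrib]
        map_smul' := fun c A => by
          ext p q
          simp [Finset.mul_sum, mul_assoc] }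
    let w : Fin m × Fin m → ℂ := fun r => if r.1 = r.2 then 1 else 0
    refine ⟨Φ, Matrix.vecMulVec w (star w), ?_, Matrix.posSemidef_vecMulVec_self_star w, ?_⟩
    · intro A hA
      obtain ⟨N, v, rfl⟩ := Matrix.posSemidef_iff_eq_sum_vecMulVec.mp hA
      rw [map_sum]
      refine Matrix.posSemidef_sum _ fun l _ => ?_
      rw [← Matrix.isPositive_toEuclideanLin_iff, LinearMap.isPositive_iff_complex]
      intro b
      have hb := h (star (v l)) b.ofLp
      have e : inner ℂ b (Matrix.toEuclideanLin (Φ (Matrix.vecMulVec (v l) (star (v l)))) b) =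
          star (fun r : Fin m × Fin n => star (v l) r.1 * b.ofLp r.2) ⬝ᵥ
            W.mulVec (fun r : Fin m × Fin n => star (v l) r.1 * b.ofLp r.2) := by
        rw [EuclideanSpace.inner_eq_star_dotProduct, Matrix.ofLp_toLpLin, Matrix.toLin'_apply]
        simp only [Φ, LinearMap.coe_mk, AddHom.coe_mk, dotProduct, Matrix.mulVec, Matrix.of_apply,
          Matrix.vecMulVec_apply, Fintype.sum_prod_type, Pi.star_apply, star_mul', star_star,
          Finset.mul_sum, Finset.sum_mul]
        conv_rhs => rw [Finset.sum_comm]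
        refine Finset.sum_congr rfl fun p _ => ?_
        rw [Finset.sum_comm]
        refine Finset.sum_congr rfl fun i _ => ?_
        rw [Finset.sum_comm]
        refine Finset.sum_congr rfl fun j _ => Finset.sum_congr rfl fun q _ => ?_
        ring
      rw [← e, ← inner_conj_symm] at hb
      have hc := star_nonneg_iff.mp hb
      obtain ⟨h1, h2⟩ := Complex.nonneg_iff.mp hc
      exact ⟨Complex.ext rfl h2, h1⟩
    · ext ⟨i, p⟩ ⟨j, q⟩
      change W (i, p) (j, q) = ∑ i', ∑ j', (w (i, i') * star (w (j, j'))) * W (i', p) (j', q)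
      simp [w, apply_ite]

theorem exists_large_root {a b c : ℂ} (ha : a ≠ 0) :
    ∃ t : ℂ, c + 2 * t * b + t ^ 2 * a = 0 ∧ ‖c‖ ≤ ‖a‖ * ‖t‖ ^ 2 := by
  obtain ⟨s, hs⟩ := IsAlgClosed.exists_pow_nat_eq (b ^ 2 - a * c) two_pos
  have hprod : ‖(-b + s) / a‖ * ‖(-b - s) / a‖ = ‖c‖ / ‖a‖ := by
    rw [← norm_mul, ← norm_div]
    congr 1
    field_simp
    linear_combination -hs
  have hc : ‖c‖ = ‖a‖ * (‖(-b + s) / a‖ * ‖(-b - s) / a‖) := by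
    rw [hprod]
    field_simp
  rcases le_total ‖(-b + s) / a‖ ‖(-b - s) / a‖ with h | h
  · refine ⟨(-b - s) / a, ?_, ?_⟩
    · field_simp
      linear_combination hs
    · rw [hc, sq]
      gcongr
  · refine ⟨(-b + s) / a, ?_, ?_⟩
    · field_simp
      linear_combination hs
    · rw [hc, sq]
      gcongr

section IsotropicVectors

variable {ι : Type*} [Fintype ι]

/-- The real diagonal Hermitian form with diagonal `μ`. -/
noncomputable def diagForm (μ : ι → ℝ) (u : ι → ℂ) : ℝ := ∑ i, μ i * ‖u i‖ ^ 2

theorem dotProduct_mulVec_comm_of_isSymm {G : Matrix ι ι ℂ} (hG : G.IsSymm) (u v : ι → ℂ) :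
    u ⬝ᵥ G.mulVec v = v ⬝ᵥ G.mulVec u := by
  rw [Matrix.dotProduct_mulVec, dotProduct_comm, ← Matrix.mulVec_transpose, hG.eq]

theorem diagForm_smul (μ : ι → ℝ) (r : ℂ) (u : ι → ℂ) :
    diagForm μ (r • u) = ‖r‖ ^ 2 * diagForm μ u := by
  simp only [diagForm, Finset.mul_sum, Pi.smul_apply, smul_eq_mul, norm_mul]
  exact Finset.sum_congr rfl fun i _ => by ring

theorem diagForm_parallelogram (μ : ι → ℝ) (u v : ι → ℂ) :
    diagForm μ (u + v) + diagForm μ (u - v) = 2 * (diagForm μ u + diagForm μ v) := by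
  simp only [diagForm, Finset.mul_sum, ← Finset.sum_add_distrib]
  refine Finset.sum_congr rfl fun i _ => ?_
  have := parallelogram_law_with_norm ℝ (u i) (v i)
  simp only [Pi.add_apply, Pi.sub_apply]
  linear_combination μ i * this

variable [DecidableEq ι]

theorem diagForm_add_single {μ : ι → ℝ} {n : ι} {u : ι → ℂ} (hu : u n = 0) (t : ℂ) :
    diagForm μ (u + Pi.single n t) = diagForm μ u + μ n * ‖t‖ ^ 2 := by
  simp only [diagForm]
  rw [← Finset.add_sum_erase _ _ (Finset.mem_univ n),
    ← Finset.add_sum_erase Finset.univ (fun i => μ i * ‖u i‖ ^ 2) (Finset.mem_univ n),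
    Finset.sum_congr rfl fun i hi => by
      rw [Pi.add_apply, Pi.single_eq_of_ne (Finset.ne_of_mem_erase hi), add_zero]]
  simp [hu]
  ring

theorem diagForm_single (μ : ι → ℝ) (n : ι) (t : ℂ) :
    diagForm μ (Pi.single n t) = μ n * ‖t‖ ^ 2 := by
  simpa [diagForm] using diagForm_add_single (μ := μ) (n := n) (u := 0) rfl t

variable {G : Matrix ι ι ℂ} {μ : ι → ℝ} {n : ι}

/-- `μ` is nonnegative on the isotropic vectors of the complex bilinear form `G`. -/
def NonnegOnIsotropic (G : Matrix ι ι ℂ) (μ : ι → ℝ) : Prop :=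
  ∀ c : ι → ℂ, c ⬝ᵥ G.mulVec c = 0 → 0 ≤ diagForm μ c

theorem NonnegOnIsotropic.apply_ne_zero (h : NonnegOnIsotropic G μ) (hn : μ n < 0) :
    G n n ≠ 0 := by
  intro h0
  have := h (Pi.single n 1) (by simpa using h0)
  simp [diagForm_single] at this
  linarith

theorem NonnegOnIsotropic.neg_mul_norm_le (h : NonnegOnIsotropic G μ) (hG : G.IsSymm)
    (hn : μ n < 0) {u : ι → ℂ} (hu : u n = 0) :
    -μ n * ‖u ⬝ᵥ G.mulVec u‖ ≤ ‖G n n‖ * diagForm μ u := by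
  obtain ⟨t, ht, hle⟩ := exists_large_root (b := G.mulVec u n) (c := u ⬝ᵥ G.mulVec u)
    (h.apply_ne_zero hn)
  have h1 := h (u + Pi.single n t) (by
    rw [Matrix.mulVec_add, dotProduct_add, add_dotProduct, add_dotProduct,
      dotProduct_mulVec_comm_of_isSymm hG u (Pi.single n t), ← ht]
    simp
    ring)
  rw [diagForm_add_single hu] at h1
  have h2 : -μ n * ‖u ⬝ᵥ G.mulVec u‖ ≤ -μ n * (‖G n n‖ * ‖t‖ ^ 2) := by
    gcongr
    linarith
  nlinarith [mul_nonneg (norm_nonneg (G n n)) h1]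

theorem NonnegOnIsotropic.diagForm_nonneg (h : NonnegOnIsotropic G μ) (hG : G.IsSymm)
    (hn : μ n < 0) {u : ι → ℂ} (hu : u n = 0) : 0 ≤ diagForm μ u := by
  have h1 := h.neg_mul_norm_le hG hn hu
  have h2 : 0 < ‖G n n‖ := norm_pos_iff.mpr (h.apply_ne_zero hn)
  refine nonneg_of_mul_nonneg_right (le_trans ?_ h1) h2
  exact mul_nonneg (by linarith) (norm_nonneg _)

theorem NonnegOnIsotropic.neg_mul_norm_polar_le (h : NonnegOnIsotropic G μ) (hG : G.IsSymm)
    (hn : μ n < 0) {u v : ι → ℂ} (hu : u n = 0) (hv : v n = 0) :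
    2 * (-μ n * ‖u ⬝ᵥ G.mulVec v‖) ≤ ‖G n n‖ * (diagForm μ u + diagForm μ v) := by
  have h1 := h.neg_mul_norm_le hG hn (u := u + v) (by simp [hu, hv])
  have h2 := h.neg_mul_norm_le hG hn (u := u - v) (by simp [hu, hv])
  have h3 : 4 * ‖u ⬝ᵥ G.mulVec v‖ ≤
      ‖(u + v) ⬝ᵥ G.mulVec (u + v)‖ + ‖(u - v) ⬝ᵥ G.mulVec (u - v)‖ := by
    refine le_trans (le_of_eq ?_) (norm_sub_le _ _)
    rw [← Complex.norm_ofNat 4, ← norm_mul]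
    congr 1
    simp only [Matrix.mulVec_add, Matrix.mulVec_sub, dotProduct_add, add_dotProduct,
      dotProduct_sub, sub_dotProduct, dotProduct_mulVec_comm_of_isSymm hG v u]
    ring
  have h4 := diagForm_parallelogram μ u v
  have h5 : -μ n * (4 * ‖u ⬝ᵥ G.mulVec v‖) ≤ -μ n * (‖(u + v) ⬝ᵥ G.mulVec (u + v)‖ +
      ‖(u - v) ⬝ᵥ G.mulVec (u - v)‖) := by
    gcongr
    linarith
  have h6 : ‖G n n‖ * (diagForm μ (u + v) + diagForm μ (u - v)) =
    ‖G n n‖ * (2 * (diagForm μ u + diagForm μ v)) := by rw [h4]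
  linarith

theorem NonnegOnIsotropic.sq_le (h : NonnegOnIsotropic G μ) (hG : G.IsSymm)
    (hn : μ n < 0) {u v : ι → ℂ} (hu : u n = 0) (hv : v n = 0) :
    (-μ n * ‖u ⬝ᵥ G.mulVec v‖) ^ 2 ≤ ‖G n n‖ ^ 2 * (diagForm μ u * diagForm μ v) := by
  have hd : discrim (‖G n n‖ * diagForm μ u) (-(2 * (-μ n * ‖u ⬝ᵥ G.mulVec v‖)))
      (‖G n n‖ * diagForm μ v) ≤ 0 := by
    refine discrim_le_zero fun s => ?_
    have h1 := h.neg_mul_norm_polar_le hG hn (u := (s : ℂ) • u) (by simp [hu]) hv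
    rw [diagForm_smul, smul_dotProduct, norm_smul, Complex.norm_real, Real.norm_eq_abs,
      sq_abs] at h1
    have h2 : s * (-μ n * ‖u ⬝ᵥ G.mulVec v‖) ≤ |s| * (-μ n * ‖u ⬝ᵥ G.mulVec v‖) :=
      mul_le_mul_of_nonneg_right (le_abs_self s) (mul_nonneg (by linarith) (norm_nonneg _))
    nlinarith
  rw [discrim] at hd
  nlinarith

/-- The vector dual to `u` under the form `G`, projected orthogonally to `n`. -/
def dualVec (G : Matrix ι ι ℂ) (n : ι) (u : ι → ℂ) : ι → ℂ :=
  Function.update (star (G.mulVec u)) n 0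

theorem dualVec_self (u : ι → ℂ) : dualVec G n u n = 0 := by simp [dualVec]

theorem dotProduct_mulVec_dualVec (hG : G.IsSymm) (u : ι → ℂ) :
    u ⬝ᵥ G.mulVec (dualVec G n u) = ((∑ i, ‖dualVec G n u i‖ ^ 2 : ℝ) : ℂ) := by
  rw [dotProduct_mulVec_comm_of_isSymm hG, dotProduct]
  push_cast
  refine Finset.sum_congr rfl fun i _ => ?_
  by_cases hi : i = n
  · subst hi
    simp [dualVec]
  · simp [dualVec, hi, ← Complex.conj_mul']

theorem sum_norm_sq_mulVec (hU : G.conjTranspose * G = 1) (u : ι → ℂ) :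
    ∑ i, ‖G.mulVec u i‖ ^ 2 = ∑ i, ‖u i‖ ^ 2 := by
  have key : ∀ w : ι → ℂ, ((∑ i, ‖w i‖ ^ 2 : ℝ) : ℂ) = star w ⬝ᵥ w := fun w => by
    simp [dotProduct, ← Complex.conj_mul']
  have : ((∑ i, ‖G.mulVec u i‖ ^ 2 : ℝ) : ℂ) = ((∑ i, ‖u i‖ ^ 2 : ℝ) : ℂ) := by
    rw [key, key, Matrix.star_mulVec, ← Matrix.dotProduct_mulVec, Matrix.mulVec_mulVec, hU,
      Matrix.one_mulVec]
  exact_mod_cast this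

theorem norm_sq_mul_le_dualVec (hG : G.IsSymm) (hU : G.conjTranspose * G = 1) {u : ι → ℂ}
    (hu : u n = 0) :
    ‖G n n‖ ^ 2 * ∑ i, ‖u i‖ ^ 2 ≤ ∑ i, ‖dualVec G n u i‖ ^ 2 := by
  have h1 : ∑ i, ‖dualVec G n u i‖ ^ 2 + ‖G.mulVec u n‖ ^ 2 = ∑ i, ‖u i‖ ^ 2 := by
    rw [← sum_norm_sq_mulVec hU u, ← Finset.add_sum_erase _ _ (Finset.mem_univ n),
      ← Finset.add_sum_erase _ (fun i => ‖G.mulVec u i‖ ^ 2) (Finset.mem_univ n),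
      Finset.sum_congr rfl fun i hi => by
        rw [dualVec, Function.update_of_ne (Finset.ne_of_mem_erase hi), Pi.star_apply, norm_star]]
    simp [dualVec]
  have h2 : ∑ i ∈ Finset.univ.erase n, ‖G n i‖ ^ 2 + ‖G n n‖ ^ 2 = 1 := by
    rw [Finset.sum_erase_add _ _ (Finset.mem_univ n)]
    have := sum_norm_sq_mulVec hU (Pi.single n 1)
    rw [← Finset.add_sum_erase Finset.univ (fun i => ‖(Pi.single n 1 : ι → ℂ) i‖ ^ 2)
      (Finset.mem_univ n), Finset.sum_eq_zero (s := Finset.univ.erase n) fun i hi => by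
        simp [Pi.single_eq_of_ne (Finset.ne_of_mem_erase hi)]] at this
    simpa [hG.apply] using this
  have h3 : ‖G.mulVec u n‖ ^ 2 ≤
      (∑ i ∈ Finset.univ.erase n, ‖G n i‖ ^ 2) * ∑ i, ‖u i‖ ^ 2 := by
    calc ‖G.mulVec u n‖ ^ 2 ≤ (∑ i ∈ Finset.univ.erase n, ‖G n i‖ * ‖u i‖) ^ 2 := by
          gcongr
          rw [Matrix.mulVec, dotProduct, ← Finset.add_sum_erase _ _ (Finset.mem_univ n), hu,
            mul_zero, zero_add]
          exact (norm_sum_le _ _).trans_eq (by simp)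
      _ ≤ (∑ i ∈ Finset.univ.erase n, ‖G n i‖ ^ 2) * ∑ i ∈ Finset.univ.erase n, ‖u i‖ ^ 2 :=
          Finset.sum_mul_sq_le_sq_mul_sq _ _ _
      _ ≤ _ := by
          gcongr
          exact Finset.erase_subset _ _
  rw [← eq_sub_iff_add_eq] at h2
  rw [h2] at h3
  linarith

/-- If `G` is a symmetric unitary form and `μ` is nonnegative on its isotropic vectors, then bounds
`α`, `β` of the form on `u` and on its dual vector give a bound for the negative entry of `μ`. -/
theorem NonnegOnIsotropic.sq_le_mul (h : NonnegOnIsotropic G μ) (hG : G.IsSymm)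
    (hU : G.conjTranspose * G = 1) (hn : μ n < 0) {u : ι → ℂ} (hu : u n = 0) (hu0 : u ≠ 0)
    {α β : ℝ} (hβ : 0 ≤ β)
    (h1 : diagForm μ u ≤ α * ∑ i, ‖u i‖ ^ 2)
    (h2 : diagForm μ (dualVec G n u) ≤ β * ∑ i, ‖dualVec G n u i‖ ^ 2) :
    μ n ^ 2 ≤ α * β := by
  have hg : 0 < ‖G n n‖ := norm_pos_iff.mpr (h.apply_ne_zero hn)
  have hu1 : 0 < ∑ i, ‖u i‖ ^ 2 := by
    obtain ⟨i, hi⟩ := Function.ne_iff.mp hu0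
    exact Finset.sum_pos' (fun _ _ => by positivity)
      ⟨i, Finset.mem_univ i, by have := norm_pos_iff.mpr hi; positivity⟩
  have h3 := norm_sq_mul_le_dualVec hG hU hu
  have h4 := h.sq_le hG hn hu (dualVec_self (G := G) u)
  rw [dotProduct_mulVec_dualVec hG, Complex.norm_real, Real.norm_eq_abs,
    abs_of_nonneg (by positivity)] at h4
  have h5 := h.diagForm_nonneg hG hn hu
  set A := ∑ i, ‖u i‖ ^ 2
  set B := ∑ i, ‖dualVec G n u i‖ ^ 2
  have hB : 0 < B := lt_of_lt_of_le (by positivity) h3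
  have h6 : diagForm μ u * diagForm μ (dualVec G n u) ≤ (α * A) * (β * B) :=
    mul_le_mul h1 h2 (h.diagForm_nonneg hG hn (dualVec_self u)) (h5.trans h1)
  have hα : 0 ≤ α := nonneg_of_mul_nonneg_left (h5.trans h1) hu1
  have h7 : μ n ^ 2 * B * B ≤ α * β * B * B := by
    calc μ n ^ 2 * B * B = (-μ n * B) ^ 2 := by ring
      _ ≤ ‖G n n‖ ^ 2 * (diagForm μ u * diagForm μ (dualVec G n u)) := h4
      _ ≤ ‖G n n‖ ^ 2 * ((α * A) * (β * B)) := by gcongr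
      _ = (‖G n n‖ ^ 2 * A) * (α * β * B) := by ring
      _ ≤ B * (α * β * B) := by gcongr
      _ = _ := by ring
  exact le_of_mul_le_mul_right (le_of_mul_le_mul_right h7 hB) hB

end IsotropicVectors

theorem NonnegOnIsotropic.inequalities {G : Matrix (Fin 4) (Fin 4) ℂ} {μ : Fin 4 → ℝ}
    (h : NonnegOnIsotropic G μ) (hG : G.IsSymm) (hU : G.conjTranspose * G = 1)
    (hμ : Antitone μ) :
    0 ≤ μ 2 ∧ -μ 1 ≤ μ 3 ∧ -Real.sqrt (μ 0 * μ 2) ≤ μ 3 := by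
  have h01 : μ 1 ≤ μ 0 := hμ (by decide)
  have h12 : μ 2 ≤ μ 1 := hμ (by decide)
  have h23 : μ 3 ≤ μ 2 := hμ (by decide)
  rcases le_or_gt 0 (μ 3) with hn | hn
  · exact ⟨by linarith, by linarith, by linarith [Real.sqrt_nonneg (μ 0 * μ 2)]⟩
  have h2 : 0 ≤ μ 2 := by
    have := h.diagForm_nonneg hG hn (u := Pi.single 2 1) (by simp)
    simpa [diagForm_single] using this
  refine ⟨h2, ?_, ?_⟩
  · obtain ⟨u, hu0, hu3, hu, hd⟩ : ∃ u : Fin 4 → ℂ, u 0 = 0 ∧ u 3 = 0 ∧ u ≠ 0 ∧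
        G.mulVec u 0 = 0 := by
      by_cases hc : G 0 1 = 0
      · exact ⟨Pi.single 1 1, by simp, by simp, by simp, by simp [hc]⟩
      · refine ⟨![0, G 0 2, -G 0 1, 0], rfl, rfl, fun h0 => hc ?_, ?_⟩
        · simpa using congrFun h0 2
        · simp [Matrix.mulVec, dotProduct, Fin.sum_univ_four]
          ring
    have key : ∀ w : Fin 4 → ℂ, w 0 = 0 → w 3 = 0 → diagForm μ w ≤ μ 1 * ∑ i, ‖w i‖ ^ 2 := by
      intro w hw0 hw3
      simp only [diagForm, Fin.sum_univ_four, hw0, hw3, norm_zero]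
      nlinarith [mul_le_mul_of_nonneg_right h12 (sq_nonneg ‖w 2‖)]
    have := h.sq_le_mul hG hU hn hu3 hu (by linarith) (key u hu0 hu3)
      (key _ (by simp [dualVec, hd]) (dualVec_self u))
    nlinarith
  · have := h.sq_le_mul hG hU hn (u := Pi.single 2 1) (α := μ 2) (β := μ 0) (by simp) (by simp)
      (by linarith) (by simp [diagForm_single, Pi.single_apply, apply_ite]) (by
        rw [diagForm, Finset.mul_sum]
        exact Finset.sum_le_sum fun i _ => by gcongr; exact hμ (Fin.zero_le i))
    rw [neg_le]
    exact Real.le_sqrt_of_sq_le (by nlinarith)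

section Spectral

theorem Antitone.eq_of_map_univ_eq {N : ℕ} {f g : Fin N → ℝ} (hf : Antitone f) (hg : Antitone g)
    (h : Finset.univ.val.map f = Finset.univ.val.map g) : f = g := by
  rw [Fin.univ_val_map, Fin.univ_val_map, Multiset.coe_eq_coe] at h
  exact List.ofFn_injective (h.eq_of_pairwise' hf.sortedGE_ofFn.pairwise hg.sortedGE_ofFn.pairwise)

theorem sortedDesc_eq_comp {N : ℕ} (μ : Fin N → ℝ) :
    sortedDesc μ = μ ∘ (Fin.revPerm.trans (Tuple.sort μ)) := rfl

theorem map_univ_sortedDesc {N : ℕ} (μ : Fin N → ℝ) :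
    Finset.univ.val.map (sortedDesc μ) = Finset.univ.val.map μ := by
  rw [sortedDesc_eq_comp, ← Multiset.map_map, Multiset.map_univ_val_equiv]

theorem exists_equiv_of_map_univ_eq {ι : Type} [Fintype ι] {N : ℕ} (e₀ : Fin N ≃ ι)
    {μ : Fin N → ℝ} {f : ι → ℝ} (h : Finset.univ.val.map f = Finset.univ.val.map μ) :
    ∃ e : Fin N ≃ ι, sortedDesc μ = f ∘ e := by
  refine ⟨(Fin.revPerm.trans (Tuple.sort (f ∘ e₀))).trans e₀, ?_⟩
  change sortedDesc μ = sortedDesc (f ∘ e₀)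
  refine (sortedDesc_antitone _).eq_of_map_univ_eq (sortedDesc_antitone _) ?_
  rw [map_univ_sortedDesc, map_univ_sortedDesc, ← h, ← Multiset.map_map,
    Multiset.map_univ_val_equiv]

variable {ι : Type} [Fintype ι]

theorem star_dotProduct_mul_diagonal_mulVec {κ : Type*} [Fintype κ] [DecidableEq κ]
    (V : Matrix ι κ ℂ) (μ : κ → ℝ) (x : ι → ℂ) :
    star x ⬝ᵥ (V * Matrix.diagonal (fun i => (μ i : ℂ)) * V.conjTranspose).mulVec x =
      (diagForm μ (V.conjTranspose.mulVec x) : ℂ) := by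
  rw [← Matrix.mulVec_mulVec, ← Matrix.mulVec_mulVec, Matrix.dotProduct_mulVec,
    ← Matrix.conjTranspose_conjTranspose V, ← Matrix.star_mulVec,
    Matrix.conjTranspose_conjTranspose]
  simp only [dotProduct, diagForm, Matrix.mulVec_diagonal, Pi.star_apply]
  push_cast
  refine Finset.sum_congr rfl fun i _ => ?_
  rw [← Complex.conj_mul', ← starRingEnd_apply]
  ring

variable [DecidableEq ι] {N : ℕ}

theorem Matrix.IsHermitian.exists_eq_mul_diagonal_sortedDesc {W : Matrix ι ι ℂ}
    (hW : W.IsHermitian) {μ : Fin N → ℝ} (h : HasEigenvalueList W μ) (e₀ : Fin N ≃ ι) :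
    ∃ V : Matrix ι (Fin N) ℂ, V * V.conjTranspose = 1 ∧ V.conjTranspose * V = 1 ∧
      W = V * Matrix.diagonal (fun i => (sortedDesc μ i : ℂ)) * V.conjTranspose := by
  rw [HasEigenvalueList, hW.roots_charpoly_eq_eigenvalues] at h
  obtain ⟨e, he⟩ := exists_equiv_of_map_univ_eq e₀ (f := hW.eigenvalues) (μ := μ) (by
    simpa [Multiset.map_map, Function.comp_def] using congrArg (Multiset.map Complex.re) h)
  set U : Matrix ι ι ℂ := (hW.eigenvectorUnitary : Matrix ι ι ℂ)
  have h1 : U * U.conjTranspose = 1 := Unitary.mul_star_self_of_mem hW.eigenvectorUnitary.2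
  have h2 : U.conjTranspose * U = 1 := Unitary.star_mul_self_of_mem hW.eigenvectorUnitary.2
  have h3 : W = U * Matrix.diagonal (fun i => (hW.eigenvalues i : ℂ)) * U.conjTranspose :=
    hW.spectral_theorem
  refine ⟨U.submatrix id e, ?_, ?_, ?_⟩
  · rw [Matrix.conjTranspose_submatrix, Matrix.submatrix_mul_equiv, h1, Matrix.submatrix_id_id]
  · rw [Matrix.conjTranspose_submatrix, ← Matrix.submatrix_mul _ _ _ _ _ Function.bijective_id, h2,
      Matrix.submatrix_one_equiv]
  · have h4 : Matrix.diagonal (fun i => (sortedDesc μ i : ℂ)) =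
        (Matrix.diagonal (fun i => (hW.eigenvalues i : ℂ))).submatrix e e := by
      rw [Matrix.submatrix_diagonal_equiv, he]
      rfl
    rw [h4, Matrix.conjTranspose_submatrix, Matrix.submatrix_mul_equiv, Matrix.submatrix_mul_equiv,
      Matrix.submatrix_id_id]
    exact h3

theorem hasEigenvalueList_mul_diagonal {V : Matrix ι (Fin N) ℂ} (hV : V.conjTranspose * V = 1)
    (hN : Fintype.card ι = N) (μ : Fin N → ℝ) :
    HasEigenvalueList (V * Matrix.diagonal (fun i => (sortedDesc μ i : ℂ)) * V.conjTranspose) μ := by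
  rw [HasEigenvalueList, Matrix.mul_assoc, Matrix.charpoly_mul_comm_of_le _ _ (by simp [hN]),
    Matrix.mul_assoc, hV, Matrix.mul_one, Matrix.charpoly_diagonal, hN, Fintype.card_fin,
    Nat.sub_self, pow_zero, one_mul, Polynomial.roots_prod]
  · simpa [Multiset.map_map, Function.comp_def] using congrArg (Multiset.map Complex.ofReal) (map_univ_sortedDesc μ)
  · simp [Finset.prod_ne_zero_iff, Polynomial.X_sub_C_ne_zero]

end Spectral

section BlockPositive

theorem Matrix.eq_zero_of_star_dotProduct_mulVec {n : ℕ} {A : Matrix (Fin n) (Fin n) ℂ}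
    (h : ∀ x, star x ⬝ᵥ A.mulVec x = 0) : A = 0 := by
  rw [← (Matrix.toEuclideanLin (𝕜 := ℂ)).map_eq_zero_iff, ← inner_map_self_eq_zero]
  intro x
  rw [inner_eq_zero_symm, EuclideanSpace.inner_eq_star_dotProduct, Matrix.ofLp_toLpLin,
    Matrix.toLin'_apply, dotProduct_comm]
  exact h _

theorem Matrix.eq_zero_of_product_form {m n : ℕ} {D : Matrix (Fin m × Fin n) (Fin m × Fin n) ℂ}
    (h : ∀ (a : Fin m → ℂ) (b : Fin n → ℂ), star (fun r : Fin m × Fin n => a r.1 * b r.2) ⬝ᵥ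
        D.mulVec (fun r : Fin m × Fin n => a r.1 * b r.2) = 0) : D = 0 := by
  have h1 : ∀ b : Fin n → ℂ, (Matrix.of fun i j => star b ⬝ᵥ
      (Matrix.of fun p q => D (i, p) (j, q)).mulVec b : Matrix (Fin m) (Fin m) ℂ) = 0 := by
    refine fun b => Matrix.eq_zero_of_star_dotProduct_mulVec fun a => ?_
    rw [← h a b]
    simp only [dotProduct, Matrix.mulVec, Matrix.of_apply, Fintype.sum_prod_type, Pi.star_apply,
      star_mul', Finset.mul_sum, Finset.sum_mul]
    refine Finset.sum_congr rfl fun i _ => ?_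
    rw [Finset.sum_comm]
    refine Finset.sum_congr rfl fun p _ => Finset.sum_congr rfl fun j _ =>
      Finset.sum_congr rfl fun q _ => by ring
  have h2 : ∀ i j, (Matrix.of fun p q => D (i, p) (j, q) : Matrix (Fin n) (Fin n) ℂ) = 0 :=
    fun i j => Matrix.eq_zero_of_star_dotProduct_mulVec fun b => congrFun (congrFun (h1 b) i) j
  ext ⟨i, p⟩ ⟨j, q⟩
  exact congrFun (congrFun (h2 i j) p) q

theorem IsBlockPositive.isHermitian {m n : ℕ} {W : Matrix (Fin m × Fin n) (Fin m × Fin n) ℂ}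
    (hW : IsBlockPositive W) : W.IsHermitian := by
  rw [isBlockPositive_iff] at hW
  refine (sub_eq_zero.mp (Matrix.eq_zero_of_product_form fun a b => ?_)).symm
  have h1 := (IsSelfAdjoint.of_nonneg (hW a b)).star_eq
  rw [Matrix.sub_mulVec, dotProduct_sub, sub_eq_zero, ← h1, ← Matrix.star_dotProduct,
    Matrix.star_mulVec, ← Matrix.dotProduct_mulVec]

/-- The symmetric form on `ℂ² ⊗ ℂ²` whose quadratic form is twice the determinant. -/
def detForm : Matrix (Fin 2 × Fin 2) (Fin 2 × Fin 2) ℂ := !![0, 1; -1, 0] ⊗ₖ !![0, 1; -1, 0]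

theorem detForm_isSymm : detForm.IsSymm := by
  ext ⟨i, p⟩ ⟨j, q⟩
  fin_cases i <;> fin_cases p <;> fin_cases j <;> fin_cases q <;> simp [detForm]

theorem detForm_conjTranspose_mul_self : detForm.conjTranspose * detForm = 1 := by
  rw [detForm, Matrix.conjTranspose_kronecker, ← Matrix.mul_kronecker_mul,
    ← Matrix.one_kronecker_one]
  congr 1 <;> ext i j <;> fin_cases i <;> fin_cases j <;> simp [Matrix.mul_apply]

theorem dotProduct_detForm_mulVec_self (x : Fin 2 × Fin 2 → ℂ) :
    x ⬝ᵥ detForm.mulVec x = 2 * (x (0, 0) * x (1, 1) - x (0, 1) * x (1, 0)) := by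
  simp [detForm, dotProduct, Matrix.mulVec, Fintype.sum_prod_type, Fin.sum_univ_two]
  ring

theorem exists_eq_mul_of_detForm_eq_zero {x : Fin 2 × Fin 2 → ℂ}
    (hx : x ⬝ᵥ detForm.mulVec x = 0) :
    ∃ a b : Fin 2 → ℂ, x = fun r => a r.1 * b r.2 := by
  rw [dotProduct_detForm_mulVec_self] at hx
  have h : x (0, 0) * x (1, 1) = x (0, 1) * x (1, 0) := by linear_combination hx / 2
  have key : ∀ a b : Fin 2 → ℂ, x (0, 0) = a 0 * b 0 → x (0, 1) = a 0 * b 1 →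
      x (1, 0) = a 1 * b 0 → x (1, 1) = a 1 * b 1 → x = fun r => a r.1 * b r.2 := by
    intro a b h1 h2 h3 h4
    ext ⟨i, j⟩
    fin_cases i <;> fin_cases j <;> assumption
  by_cases h0 : x (0, 0) = 0
  · rw [h0, zero_mul, eq_comm, mul_eq_zero] at h
    rcases h with h | h
    · exact ⟨![0, 1], ![x (1, 0), x (1, 1)], key _ _ (by simp [h0]) (by simp [h]) (by simp)
        (by simp)⟩
    · exact ⟨![x (0, 1), x (1, 1)], ![0, 1], key _ _ (by simp [h0]) (by simp) (by simp [h])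
        (by simp)⟩
  · refine ⟨![1, x (1, 0) / x (0, 0)], ![x (0, 0), x (0, 1)], key _ _ (by simp) (by simp)
      (by simp [h0]) ?_⟩
    simp
    field_simp
    linear_combination h

end BlockPositive

theorem IsBlockPositive.sortedDesc_inequalities {W : Matrix (Fin 2 × Fin 2) (Fin 2 × Fin 2) ℂ}
    {μ : Fin 4 → ℝ} (hW : IsBlockPositive W) (hμ : HasEigenvalueList W μ) :
    0 ≤ sortedDesc μ 2 ∧ -sortedDesc μ 1 ≤ sortedDesc μ 3 ∧
      -Real.sqrt (sortedDesc μ 0 * sortedDesc μ 2) ≤ sortedDesc μ 3 := by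
  obtain ⟨V, h1, h2, h3⟩ :=
    hW.isHermitian.exists_eq_mul_diagonal_sortedDesc hμ
      (finProdFinEquiv (m := 2) (n := 2)).symm
  refine NonnegOnIsotropic.inequalities (G := V.transpose * detForm * V) (fun c hc => ?_) ?_ ?_
    (sortedDesc_antitone μ)
  · rw [← Matrix.mulVec_mulVec, ← Matrix.mulVec_mulVec, Matrix.dotProduct_mulVec,
      Matrix.vecMul_transpose] at hc
    obtain ⟨a, b, hab⟩ := exists_eq_mul_of_detForm_eq_zero hc
    have h4 := (isBlockPositive_iff W).mp hW a b
    rw [← hab, h3, star_dotProduct_mul_diagonal_mulVec, Matrix.mulVec_mulVec, h2,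
      Matrix.one_mulVec] at h4
    exact_mod_cast h4
  · rw [Matrix.IsSymm, Matrix.transpose_mul, Matrix.transpose_mul, Matrix.transpose_transpose,
      detForm_isSymm.eq, Matrix.mul_assoc]
  · have h5 : V.transpose.conjTranspose * V.transpose = 1 := by
      rw [← Matrix.transpose_one, ← h1, Matrix.transpose_mul]
      rfl
    calc (V.transpose * detForm * V).conjTranspose * (V.transpose * detForm * V)
        = V.conjTranspose * (detForm.conjTranspose *
            (V.transpose.conjTranspose * V.transpose) * detForm) * V := by
          simp only [Matrix.conjTranspose_mul, Matrix.mul_assoc]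
      _ = 1 := by rw [h5, Matrix.mul_one, detForm_conjTranspose_mul_self, Matrix.mul_one, h2]

/-- Its columns are the orthonormal vectors `e₀ ⊗ e₀`, `(e₀ ⊗ e₁ + e₁ ⊗ e₀) / √2`, `e₁ ⊗ e₁` and
`(e₀ ⊗ e₁ - e₁ ⊗ e₀) / √2`. -/
noncomputable def symmBasis : Matrix (Fin 2 × Fin 2) (Fin 4) ℂ :=
  Matrix.of fun r => (![![![1, 0, 0, 0], ![0, (√2 : ℝ)⁻¹, 0, (√2 : ℝ)⁻¹]],
    ![![0, (√2 : ℝ)⁻¹, 0, -(√2 : ℝ)⁻¹], ![0, 0, 1, 0]]] : Fin 2 → Fin 2 → Fin 4 → ℂ) r.1 r.2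

theorem inv_sqrt_two_mul_self : ((√2 : ℝ) : ℂ)⁻¹ * ((√2 : ℝ) : ℂ)⁻¹ = 1 / 2 := by
  rw [← mul_inv, ← Complex.ofReal_mul, Real.mul_self_sqrt (by norm_num)]
  norm_num

theorem symmBasis_conjTranspose_mul_self : symmBasis.conjTranspose * symmBasis = 1 := by
  ext i j
  fin_cases i <;> fin_cases j <;>
    simp [symmBasis, Matrix.mul_apply, Fintype.sum_prod_type, inv_sqrt_two_mul_self] <;> norm_num

theorem diagForm_symmBasis (μ : Fin 4 → ℝ) (x : Fin 2 × Fin 2 → ℂ) :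
    diagForm μ (symmBasis.conjTranspose.mulVec x) =
      μ 0 * ‖x (0, 0)‖ ^ 2 + μ 1 * (‖x (0, 1) + x (1, 0)‖ ^ 2 / 2) +
      μ 2 * ‖x (1, 1)‖ ^ 2 + μ 3 * (‖x (0, 1) - x (1, 0)‖ ^ 2 / 2) := by
  have h : ∀ z : ℂ, ‖((√2 : ℝ) : ℂ)⁻¹ * z‖ ^ 2 = ‖z‖ ^ 2 / 2 := fun z => by
    rw [norm_mul, mul_pow, norm_inv, Complex.norm_real, inv_pow, Real.norm_eq_abs, sq_abs,
      Real.sq_sqrt (by norm_num)]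
    ring
  rw [← h, ← h, diagForm, Fin.sum_univ_four]
  simp [symmBasis, Matrix.mulVec, dotProduct, Fintype.sum_prod_type, mul_add,
    sub_eq_add_neg, -mul_eq_mul_left_iff]

theorem diagForm_symmBasis_nonneg {μ : Fin 4 → ℝ} (h0 : 0 ≤ μ 0) (h1 : 0 ≤ μ 1) (h2 : 0 ≤ μ 2)
    (h13 : -μ 1 ≤ μ 3) (h023 : -√(μ 0 * μ 2) ≤ μ 3) {x : Fin 2 × Fin 2 → ℂ}
    (hx : x (0, 0) * x (1, 1) = x (0, 1) * x (1, 0)) :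
    0 ≤ diagForm μ (symmBasis.conjTranspose.mulVec x) := by
  rw [diagForm_symmBasis]
  rcases le_or_gt 0 (μ 3) with h3 | h3
  · positivity
  have hn : ‖x (0, 0)‖ * ‖x (1, 1)‖ = ‖x (0, 1)‖ * ‖x (1, 0)‖ := by
    rw [← norm_mul, hx, norm_mul]
  have hs : √(μ 0 * μ 2) = √(μ 0) * √(μ 2) := Real.sqrt_mul h0 _
  have hpar := parallelogram_law_with_norm ℝ (x (0, 1)) (x (1, 0))
  have hsub : ‖x (0, 1) - x (1, 0)‖ ^ 2 ≤ (‖x (0, 1)‖ + ‖x (1, 0)‖) ^ 2 := by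
    gcongr
    exact norm_sub_le _ _
  have e1 : -μ 3 * ‖x (0, 1) + x (1, 0)‖ ^ 2 ≤ μ 1 * ‖x (0, 1) + x (1, 0)‖ ^ 2 := by
    gcongr
    linarith
  have e2 : -μ 3 * (‖x (0, 0)‖ * ‖x (1, 1)‖) ≤ √(μ 0) * √(μ 2) * (‖x (0, 0)‖ * ‖x (1, 1)‖) := by
    gcongr
    linarith
  have e3 := sq_nonneg (√(μ 0) * ‖x (0, 0)‖ - √(μ 2) * ‖x (1, 1)‖)
  have e4 : (√(μ 0) * ‖x (0, 0)‖) ^ 2 = μ 0 * ‖x (0, 0)‖ ^ 2 := by rw [mul_pow, Real.sq_sqrt h0]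
  have e5 : (√(μ 2) * ‖x (1, 1)‖) ^ 2 = μ 2 * ‖x (1, 1)‖ ^ 2 := by rw [mul_pow, Real.sq_sqrt h2]
  have e6 : -μ 3 * (‖x (0, 1) - x (1, 0)‖ ^ 2 - ‖x (0, 1) + x (1, 0)‖ ^ 2) ≤
      -μ 3 * (4 * (‖x (0, 0)‖ * ‖x (1, 1)‖)) := by
    apply mul_le_mul_of_nonneg_left _ (by linarith)
    nlinarith
  nlinarith

theorem mainTheorem1 (μ : Fin 4 → ℝ) :
    (∃ W : Matrix (Fin 2 × Fin 2) (Fin 2 × Fin 2) ℂ,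
        IsBlockPositive W ∧ HasEigenvalueList W μ) ↔
      0 ≤ sortedDesc μ 2 ∧
      -sortedDesc μ 1 ≤ sortedDesc μ 3 ∧
      -Real.sqrt (sortedDesc μ 0 * sortedDesc μ 2) ≤ sortedDesc μ 3 := by
  refine ⟨fun ⟨W, hW, hμ⟩ => hW.sortedDesc_inequalities hμ, fun ⟨h2, h13, h023⟩ => ?_⟩
  refine ⟨_, (isBlockPositive_iff _).mpr fun a b => ?_,
    hasEigenvalueList_mul_diagonal symmBasis_conjTranspose_mul_self rfl μ⟩
  have h1 : 0 ≤ sortedDesc μ 1 := h2.trans (sortedDesc_antitone μ (by decide))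
  rw [star_dotProduct_mul_diagonal_mulVec]
  exact_mod_cast diagForm_symmBasis_nonneg (h1.trans (sortedDesc_antitone μ (by decide))) h1 h2
    h13 h023 (by ring)
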